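/- **Setting.** Cauchy data $(M^3,g,h)$ consist of a connected smooth three-manifold $M$ without boundary, a smooth Riemannian metric $g$ and a smooth symmetric two-tensor $h$. Put $16\pi\mu=R-h^{ij}h_{ij}+(h_i{}^i)^2$ and $8\pi J^i=\nabla_j\bigl(h^{ij}-(h_k{}^k)g^{ij}\bigr)$. The data are *asymptotically flat* if, outside a compact set, $M$ is a finite disjoint union of ends diffeomorphic to $\{x\in\mathbb R^3:|x|>1\}$ in which, for some $\alpha>1/2$, $g_{ij}-\delta_{ij}=O(|x|^{-\alpha})$, $\partial_kg_{ij}=O(|x|^{-\alpha-1})$, $h_{ij}=O(|x|^{-\alpha-1})$, and $R$ is integrable near infinity. One end is chosen; the *total mass* is that of the chosen end, $m=\frac1{16\pi}\lim_{\sigma\to\infty}\int_{S_\sigma}\sum_{i,j}(g_{ij,i}\nu_j-g_{ii,j}\nu_j)\,d\mu$. Call data *admissible* if they are complete, asymptotically flat and satisfy $\mu\ge|J|$ everywhere. A *region* is an open set $D\subset M$ which contains (a neighbourhood of infinity of) every end but the chosen one and stays away from infinity in the chosen end. The surface $\partial D'$ *encloses* $\partial D$ if $D\subseteq D'$. The *area*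 of a set is its two-dimensional Hausdorff measure. A surface $\partial D$ is *outer-minimising* if $|\partial E|\ge|\partial D|$ for every region $E\supseteq D$. (For smooth $\partial D$ it is equivalent to consider only $E$ with smooth boundary.) For $\Sigma=\partial D$, an *extension* is an admissible data set obtained by replacing the outside $M\setminus \overline D$, and a *fill-in* is an admissible data set obtained by replacing the inside $D$, such that the rest of $M$, with its boundary $\Sigma$ and the data on it, is kept, and the part that corresponds to $D$ (respectively, that replaces $D$) is again a region. For outer-minimising $\Sigma$ let $m_{outer}(\Sigma)$ be the infimum of the total mass over all extensions in which $\Sigma$ remains outer-minimising, and let $m_{inner}(\Sigma)$ be the supremum of $\sqrt{A/16\pi}$ over all fill-ins, where $A$ is the infimum of the boundary areas of the regions with smooth boundary in the fill-in (the minimum area needed to enclose all ends but the chosen one). Both are taken in $[-\infty,\infty]$. **Theorem.** Let $(M^3,g,h)$ be complete, asymptotically flat Cauchy data with $\mu\ge|J|$ and a chosen end. Let $D_1\subseteq D_2$ be regions with smooth boundaries $\Sigma_1=\partial D_1$, $\Sigma_2=\partial D_2$ (so $\Sigma_2$ encloses $\Sigma_1$), both outer-minimising. Then $$m_{inner}(\Sigma_2)\ge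 m_{inner}(\Sigma_1)\qquad\text{and}\qquad m_{outer}(\Sigma_2)\ge m_{outer}(\Sigma_1).$$ -/

import Mathlib

open Set Filter Topology MeasureTheory Bundle
open scoped Manifold ContDiff ENNReal

universe u

attribute [local instance 2000] chartedSpaceSelf

noncomputable section

/-- Euclidean three-space. -/
abbrev E3 : Type := EuclideanSpace ℝ (Fin 3)

/-! ### Tensor calculus in a coordinate system of `ℝ³`

`G` and `H` are the component matrices of a metric and of a symmetric two-tensor. -/

namespace Coord

/-- The partial derivative `∂ₖ f` at `x`. -/
def partialD (k : Fin 3) (f : E3 → ℝ) (x : E3) : ℝ :=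
  fderiv ℝ f x (EuclideanSpace.single k 1)

/-- The Christoffel symbol `Γᵏᵢⱼ = ½ gᵏˡ (∂ᵢ gⱼₗ + ∂ⱼ gᵢₗ - ∂ₗ gᵢⱼ)`. -/
def christoffel (G : E3 → Matrix (Fin 3) (Fin 3) ℝ) (k i j : Fin 3) (x : E3) : ℝ :=
  (1 / 2) * ∑ l, (G x)⁻¹ k l *
    (partialD i (fun y => G y j l) x + partialD j (fun y => G y i l) x
      - partialD l (fun y => G y i j) x)

/-- The Ricci tensor `Rᵢⱼ = ∂ₖ Γᵏᵢⱼ - ∂ⱼ Γᵏᵢₖ + Γᵏₖₗ Γˡᵢⱼ - Γᵏⱼₗ Γˡᵢₖ`. -/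
def ricci (G : E3 → Matrix (Fin 3) (Fin 3) ℝ) (i j : Fin 3) (x : E3) : ℝ :=
  ∑ k, (partialD k (christoffel G k i j) x - partialD j (christoffel G k i k) x
    + ∑ l, (christoffel G k k l x * christoffel G l i j x
      - christoffel G k j l x * christoffel G l i k x))

/-- The scalar curvature `R = gⁱʲ Rᵢⱼ`. -/
def scalarCurvature (G : E3 → Matrix (Fin 3) (Fin 3) ℝ) (x : E3) : ℝ :=
  ∑ i, ∑ j, (G x)⁻¹ i j * ricci G i j x

/-- `hⁱʲ = gⁱᵏ hₖₗ gˡʲ`. -/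
def raised (G H : E3 → Matrix (Fin 3) (Fin 3) ℝ) (x : E3) : Matrix (Fin 3) (Fin 3) ℝ :=
  (G x)⁻¹ * H x * (G x)⁻¹

/-- The trace `gⁱʲ hᵢⱼ`. -/
def traceH (G H : E3 → Matrix (Fin 3) (Fin 3) ℝ) (x : E3) : ℝ :=
  ∑ i, ∑ j, (G x)⁻¹ i j * H x i j

/-- The energy density `μ = (R - hⁱʲ hᵢⱼ + (tr h)²) / 16π`. -/
def energyDensity (G H : E3 → Matrix (Fin 3) (Fin 3) ℝ) (x : E3) : ℝ :=
  1 / (16 * Real.pi) *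
    (scalarCurvature G x - ∑ i, ∑ j, raised G H x i j * H x i j + traceH G H x ^ 2)

/-- The components `hⁱʲ - (tr h) gⁱʲ`. -/
def momentum (G H : E3 → Matrix (Fin 3) (Fin 3) ℝ) (i j : Fin 3) (x : E3) : ℝ :=
  raised G H x i j - traceH G H x * (G x)⁻¹ i j

/-- The current density `Jⁱ = ∇ⱼ (hⁱʲ - (tr h) gⁱʲ) / 8π`. -/
def currentDensity (G H : E3 → Matrix (Fin 3) (Fin 3) ℝ) (i : Fin 3) (x : E3) : ℝ :=
  1 / (8 * Real.pi) * ∑ j, (partialD j (momentum G H i j) x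
    + ∑ k, (christoffel G i j k x * momentum G H k j x
      + christoffel G j j k x * momentum G H i k x))

/-- The length `|J|`. -/
def currentNorm (G H : E3 → Matrix (Fin 3) (Fin 3) ℝ) (x : E3) : ℝ :=
  Real.sqrt (∑ i, ∑ j, G x i j * currentDensity G H i x * currentDensity G H j x)

/-- The flux `(1/16π) ∫ (gᵢⱼ,ᵢ νⱼ - gᵢᵢ,ⱼ νⱼ) dμ` through the coordinate sphere of radius `s`;
the integral is pulled back to the unit sphere by `ξ ↦ s ξ`. -/
def massFlux (G : E3 → Matrix (Fin 3) (Fin 3) ℝ) (s : ℝ) : ℝ :=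
  1 / (16 * Real.pi) *
    ∫ ξ : Metric.sphere (0 : E3) 1,
      s ^ 2 * ∑ i, ∑ j, (partialD i (fun y => G y i j) (s • (ξ : E3))
        - partialD j (fun y => G y i i) (s • (ξ : E3))) * (ξ : E3) j
      ∂((volume : Measure E3).toSphere)

end Coord

/-! ### Cauchy data -/

/-- The normalised two-dimensional Hausdorff measure of a set in a metric space. The factor
`π / 4`, the area of a disc of diameter one, turns the gauge `diam ^ 2` into area. -/
def hausdorffArea {α : Type*} [EMetricSpace α] (S : Set α) : ℝ≥0∞ :=
  letI : MeasurableSpace α := borel α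
  haveI : BorelSpace α := ⟨rfl⟩
  ENNReal.ofReal (Real.pi / 4) * Measure.hausdorffMeasure 2 S

/-- Cauchy data `(M³, g, h)`: a connected smooth three-manifold without boundary, with a smooth
Riemannian metric `g` and a smooth symmetric two-tensor `h`. -/
structure CauchyData : Type (u + 1) where
  /-- The underlying set of the manifold. -/
  carrier : Type u
  [top : TopologicalSpace carrier]
  [charted : ChartedSpace E3 carrier]
  [smooth : IsManifold (𝓡 3) ∞ carrier]
  [t2 : T2Space carrier]
  [secondCountable : SecondCountableTopology carrier]
  [connected : ConnectedSpace carrier]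
  /-- The metric. -/
  g : ContMDiffRiemannianMetric (𝓡 3) ∞ E3 (fun p : carrier => TangentSpace (𝓡 3) p)
  /-- The second fundamental form. -/
  h (p : carrier) : TangentSpace (𝓡 3) p →L[ℝ] TangentSpace (𝓡 3) p →L[ℝ] ℝ
  h_symm (p : carrier) (v w : TangentSpace (𝓡 3) p) : h p v w = h p w v
  h_smooth : ContMDiff (𝓡 3) ((𝓡 3).prod 𝓘(ℝ, E3 →L[ℝ] E3 →L[ℝ] ℝ)) ∞
    (fun p => TotalSpace.mk' (E3 →L[ℝ] E3 →L[ℝ] ℝ)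
      (E := fun p : carrier => TangentSpace (𝓡 3) p →L[ℝ] TangentSpace (𝓡 3) p →L[ℝ] ℝ) p (h p))

namespace CauchyData

attribute [instance] top charted smooth t2 secondCountable connected

/-- The distance of `(M, g)`, the infimum of the lengths of curves; it induces the topology
of `M`. -/
@[reducible] def distance (X : CauchyData.{u}) : EMetricSpace X.carrier :=
  letI : LocallyCompactSpace X.carrier := ChartedSpace.locallyCompactSpace E3 X.carrier
  letI : RiemannianBundle (fun p : X.carrier => TangentSpace (𝓡 3) p) :=
    ⟨X.g.toRiemannianMetric⟩
  haveI : IsContMDiffRiemannianBundle (𝓡 3) ∞ E3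
      (fun p : X.carrier => TangentSpace (𝓡 3) p) := ⟨X.g.inner, X.g.contMDiff, fun _ _ _ => rfl⟩
  haveI : IsContinuousRiemannianBundle E3 (fun p : X.carrier => TangentSpace (𝓡 3) p) :=
    ⟨X.g.inner, X.g.contMDiff.continuous, fun _ _ _ => rfl⟩
  haveI : IsManifold (𝓡 3) 1 X.carrier := IsManifold.of_le (n := ∞) (by exact_mod_cast le_top)
  EMetricSpace.ofRiemannianMetric (𝓡 3) X.carrier

/-- `(M, g)` is a complete metric space. -/
def IsComplete (X : CauchyData.{u}) : Prop :=
  @CompleteSpace X.carrier X.distance.toUniformSpace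

/-- The area of a set: its two-dimensional Hausdorff measure for the distance of `(M, g)`. -/
def area (X : CauchyData.{u}) (S : Set X.carrier) : ℝ≥0∞ :=
  @hausdorffArea X.carrier X.distance S

/-- The components of `g` in a coordinate system. -/
def gCoord (X : CauchyData.{u}) (c : OpenPartialHomeomorph X.carrier E3) (x : E3) :
    Matrix (Fin 3) (Fin 3) ℝ :=
  Matrix.of fun i j => X.g.inner (c.symm x)
    (mfderiv (𝓡 3) (𝓡 3) c.symm x (EuclideanSpace.single i (1 : ℝ)))
    (mfderiv (𝓡 3) (𝓡 3) c.symm x (EuclideanSpace.single j (1 : ℝ)))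

/-- The components of `h` in a coordinate system. -/
def hCoord (X : CauchyData.{u}) (c : OpenPartialHomeomorph X.carrier E3) (x : E3) :
    Matrix (Fin 3) (Fin 3) ℝ :=
  Matrix.of fun i j => X.h (c.symm x)
    (mfderiv (𝓡 3) (𝓡 3) c.symm x (EuclideanSpace.single i (1 : ℝ)))
    (mfderiv (𝓡 3) (𝓡 3) c.symm x (EuclideanSpace.single j (1 : ℝ)))

/-- The dominant energy condition `μ ≥ |J|` at every point. -/
def DominantEnergy (X : CauchyData.{u}) : Prop :=
  ∀ c ∈ atlas E3 X.carrier, ∀ x ∈ c.target,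
    Coord.currentNorm (X.gCoord c) (X.hCoord c) x
      ≤ Coord.energyDensity (X.gCoord c) (X.hCoord c) x

/-! ### Ends, asymptotic flatness and total mass -/

/-- The part `{|x| > r}` of the coordinate domain of an end. -/
def farEnd (X : CauchyData.{u}) (c : OpenPartialHomeomorph X.carrier E3) (r : ℝ) :
    Set X.carrier :=
  {p | p ∈ c.source ∧ r < ‖c p‖}

/-- `c` is an asymptotically flat coordinate system of an end: a diffeomorphism of an open set
onto `{|x| > 1}`, with `|x| → ∞` leading to infinity in `M`, such that, for some `α > 1/2`, `gᵢⱼ - δᵢⱼ = O(|x|^(-α))`,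
`∂ₖ gᵢⱼ = O(|x|^(-α-1))` and `hᵢⱼ = O(|x|^(-α-1))` at infinity, with scalar curvature integrable
near infinity. -/
structure IsAsymptoticallyFlatEnd (X : CauchyData.{u})
    (c : OpenPartialHomeomorph X.carrier E3) : Prop where
  smooth_chart : c ∈ IsManifold.maximalAtlas (𝓡 3) ∞ X.carrier
  target_eq : c.target = {x | 1 < ‖x‖}
  closed_far : ∀ r : ℝ, 1 < r → IsClosed {p | p ∈ c.source ∧ r ≤ ‖c p‖}
  decay : ∃ α : ℝ, 1 / 2 < α ∧ ∀ i j : Fin 3,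
    (fun x => X.gCoord c x i j - (1 : Matrix (Fin 3) (Fin 3) ℝ) i j)
        =O[Bornology.cobounded E3] (fun x => ‖x‖ ^ (-α)) ∧
    (∀ k : Fin 3, (Coord.partialD k fun x => X.gCoord c x i j)
        =O[Bornology.cobounded E3] (fun x => ‖x‖ ^ (-α - 1))) ∧
    (fun x => X.hCoord c x i j)
        =O[Bornology.cobounded E3] (fun x => ‖x‖ ^ (-α - 1))
  scalar_integrable :
    IntegrableAtFilter (Coord.scalarCurvature (X.gCoord c)) (Bornology.cobounded E3) volume

/-- The data are asymptotically flat, and `e` is the coordinate system of the chosen end: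
finitely many asymptotically flat ends, `e` among them, with disjoint domains, cover everything
outside of a compact set. The complement of the parts `{|x| > r}` of the ends is compact for
every `r ≥ 1`, so nothing is hidden where `|x|` tends to `1`. -/
def IsAsymptoticallyFlat (X : CauchyData.{u}) (e : OpenPartialHomeomorph X.carrier E3) : Prop :=
  ∃ (n : ℕ) (c : Fin (n + 1) → OpenPartialHomeomorph X.carrier E3),
    c 0 = e ∧ (∀ i, X.IsAsymptoticallyFlatEnd (c i)) ∧
    (∀ i j, i ≠ j → Disjoint (c i).source (c j).source) ∧
    ∀ r : ℝ, 1 ≤ r → IsCompact (⋃ i, X.farEnd (c i) r)ᶜ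

/-- Complete, asymptotically flat (with chosen end `e`), and `μ ≥ |J|`. -/
structure IsAdmissible (X : CauchyData.{u}) (e : OpenPartialHomeomorph X.carrier E3) :
    Prop where
  complete : X.IsComplete
  asymptoticallyFlat : X.IsAsymptoticallyFlat e
  dominantEnergy : X.DominantEnergy

/-- `m` is the total mass of the end with coordinate system `e`. -/
def HasTotalMass (X : CauchyData.{u}) (e : OpenPartialHomeomorph X.carrier E3) (m : ℝ) : Prop :=
  Tendsto (Coord.massFlux (X.gCoord e)) atTop (𝓝 m)

/-! ### Regions, enclosing and outer-minimising -/

/-- `D` is an open region which contains all ends but the chosen one `e`: it stays away from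
infinity in the end `e`, and what remains outside of `D` and of a neighbourhood of infinity in
the end `e` is compact. The corresponding surface is `frontier D`, and `frontier D'` encloses
`frontier D` if `D ⊆ D'`. -/
def IsRegion (X : CauchyData.{u}) (e : OpenPartialHomeomorph X.carrier E3)
    (D : Set X.carrier) : Prop :=
  IsOpen D ∧ ∃ r : ℝ, 1 ≤ r ∧ Disjoint D (X.farEnd e r) ∧ IsCompact (D ∪ X.farEnd e r)ᶜ

/-- The boundary of `D` is a smooth surface with `D` on one side: near each of its points, `D`
is a sublevel set of a smooth function without critical point there. -/
def HasSmoothBoundary (X : CauchyData.{u}) (D : Set X.carrier) : Prop :=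
  ∀ p ∈ frontier D, ∃ (U : Set X.carrier) (f : X.carrier → ℝ),
    IsOpen U ∧ p ∈ U ∧ ContMDiffOn (𝓡 3) 𝓘(ℝ, ℝ) ∞ f U ∧ mfderiv (𝓡 3) 𝓘(ℝ, ℝ) f p ≠ 0 ∧
    ∀ q ∈ U, q ∈ D ↔ f q < 0

/-- The surface `frontier D` is outer-minimising: every surface which bounds a region and
encloses it has at least as much area. -/
def IsOuterMinimising (X : CauchyData.{u}) (e : OpenPartialHomeomorph X.carrier E3)
    (D : Set X.carrier) : Prop :=
  ∀ E : Set X.carrier, X.IsRegion e E → D ⊆ E → X.area (frontier D) ≤ X.area (frontier E)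

/-- The minimum area needed to enclose all ends but the chosen one: the infimum of the boundary
areas of the open regions with smooth boundary which contain all ends but `e`. -/
def minEnclosingArea (X : CauchyData.{u}) (e : OpenPartialHomeomorph X.carrier E3) : ℝ≥0∞ :=
  ⨅ (E : Set X.carrier) (_ : X.IsRegion e E) (_ : X.HasSmoothBoundary E), X.area (frontier E)

/-! ### Extensions, fill-ins and the two masses -/

/-- `φ` identifies the data of `X` on `C` with those of `Y` on `φ '' C`: it is a diffeomorphism
from a neighbourhood of `C` which takes `g` and `h` of `X` to those of `Y` at the points of `C`
(but not necessarily elsewhere). -/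
structure IdentifiesOn (X Y : CauchyData.{u}) (φ : OpenPartialHomeomorph X.carrier Y.carrier)
    (C : Set X.carrier) : Prop where
  subset_source : C ⊆ φ.source
  contMDiffOn : ContMDiffOn (𝓡 3) (𝓡 3) ∞ φ φ.source
  contMDiffOn_symm : ContMDiffOn (𝓡 3) (𝓡 3) ∞ φ.symm φ.target
  metric_eq : ∀ p ∈ C, ∀ v w : TangentSpace (𝓡 3) p,
    Y.g.inner (φ p) (mfderiv (𝓡 3) (𝓡 3) φ p v) (mfderiv (𝓡 3) (𝓡 3) φ p w) = X.g.inner p v w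
  form_eq : ∀ p ∈ C, ∀ v w : TangentSpace (𝓡 3) p,
    Y.h (φ p) (mfderiv (𝓡 3) (𝓡 3) φ p v) (mfderiv (𝓡 3) (𝓡 3) φ p w) = X.h p v w

/-- `Y`, with chosen end `e'`, is an extension of `X`: it results from replacing the outside of
`D`, where `D' ⊆ Y` is the region that corresponds to `D`. -/
def IsExtension (X : CauchyData.{u}) (D : Set X.carrier)
    (Y : CauchyData.{u}) (e' : OpenPartialHomeomorph Y.carrier E3) (D' : Set Y.carrier) : Prop :=
  Y.IsAdmissible e' ∧ Y.IsRegion e' D' ∧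
    ∃ φ : OpenPartialHomeomorph X.carrier Y.carrier,
      X.IdentifiesOn Y φ (closure D) ∧ φ '' D = D' ∧ φ '' closure D = closure D'

/-- `Y`, with chosen end `e'`, is a fill-in of `X`: it results from replacing the region `D` by
a region `D'`, everything outside being kept. -/
def IsFillIn (X : CauchyData.{u}) (D : Set X.carrier)
    (Y : CauchyData.{u}) (e' : OpenPartialHomeomorph Y.carrier E3) (D' : Set Y.carrier) : Prop :=
  Y.IsAdmissible e' ∧ Y.IsRegion e' D' ∧
    ∃ φ : OpenPartialHomeomorph X.carrier Y.carrier,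
      X.IdentifiesOn Y φ Dᶜ ∧ φ '' Dᶜ = D'ᶜ

/-- The Bartnik outer mass of `frontier D`: the infimum of the total mass over all extensions
in which the surface remains outer-minimising. -/
def outerMass (X : CauchyData.{u}) (D : Set X.carrier) : EReal :=
  sInf {a : EReal | ∃ (Y : CauchyData.{u}) (e' : OpenPartialHomeomorph Y.carrier E3)
    (D' : Set Y.carrier) (m : ℝ), X.IsExtension D Y e' D' ∧ Y.IsOuterMinimising e' D' ∧
      Y.HasTotalMass e' m ∧ a = (m : EReal)}

/-- The inner mass of `frontier D`: the supremum of `√(A / 16π)` over all fill-ins, where `A` is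
the minimum area needed to enclose all ends of the fill-in but the chosen one. -/
def innerMass (X : CauchyData.{u}) (D : Set X.carrier) : EReal :=
  sSup {a : EReal | ∃ (Y : CauchyData.{u}) (e' : OpenPartialHomeomorph Y.carrier E3)
    (D' : Set Y.carrier), X.IsFillIn D Y e' D' ∧
      a = ((Y.minEnclosingArea e' / ENNReal.ofReal (16 * Real.pi)) ^ (1 / 2 : ℝ) : ℝ≥0∞)}

end CauchyData

end

/-! Both inequalities compare the competitors. A fill-in of `D₁` already is a fill-in of `D₂`:
declare the part of `D₂ \ D₁` that was kept to be inside as well. So the supremum for `D₂` runs over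
a larger set (`IsFillIn.exists_of_subset`).

Dually, an extension `Y` of `D₂` in which `Σ₂` stays outer-minimising is an extension of `D₁`; the
point is that `Σ₁` stays outer-minimising in `Y` (`IsExtension.image_of_subset`). Let `E` be a
region of `Y` containing the copy of `D₁`, and `D'` the copy of `D₂`. Then `|∂(E ∩ D')| + |∂(E ∪
D')| ≤ |∂E| + |∂D'|`, while `|∂D'| ≤ |∂(E ∪ D')|`. Since `|∂D'|` is finite, it cancels and `|∂(E ∩
D')| ≤ |∂E|`. But `E ∩ D'` is a copy of a region of `X` between `D₁` and `D₂`, whose boundary has at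
least the area of `Σ₁`.

Areas must therefore agree in `X` and `Y`, although distances are measured along curves that may
leave the common part, and the metrics agree on that closed part only (`IdentifiesOn.area_image`).
-/

/-! ### Hausdorff measure: Lipschitz images, boundaries of unions and intersections, level sets. -/

section Hausdorff

open scoped NNReal

/-- Countably many of the neighbourhoods cover `S`; making them disjoint keeps the constant `K ^ d`
when the pieces are summed. -/
lemma hausdorffMeasure_image_le_of_locally_lipschitz {α β : Type*} [EMetricSpace α]
    [MeasurableSpace α] [BorelSpace α] [SecondCountableTopology α] [EMetricSpace β]
    [MeasurableSpace β] [BorelSpace β] {f : α → β} {S : Set α} {K : ℝ≥0} {d : ℝ} (hd : 0 ≤ d)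
    (h : ∀ p ∈ S, ∃ V ∈ 𝓝 p, LipschitzOnWith K f V) :
    Measure.hausdorffMeasure d (f '' S) ≤ (K : ℝ≥0∞) ^ d * Measure.hausdorffMeasure d S := by
  rcases S.eq_empty_or_nonempty with rfl | hne
  · simp
  choose! V hV hlip using h
  obtain ⟨t, htS, htc, ht⟩ := TopologicalSpace.countable_cover_nhdsWithin
    (f := fun p => interior (V p)) (s := S)
    fun p hp => mem_nhdsWithin_of_mem_nhds (interior_mem_nhds.2 (hV p hp))
  have htne : t.Nonempty := by
    obtain ⟨p, hp⟩ := hne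
    obtain ⟨q, hq, -⟩ := mem_iUnion₂.1 (ht hp)
    exact ⟨q, hq⟩
  obtain ⟨g, rfl⟩ := htc.exists_eq_range htne
  set A : ℕ → Set α := disjointed fun n => interior (V (g n)) with hA
  have hAm : ∀ n, MeasurableSet (A n) :=
    MeasurableSet.disjointed fun n => isOpen_interior.measurableSet
  have hcover : S ⊆ ⋃ n, A n := by
    rw [hA, iUnion_disjointed]
    simpa using ht
  calc Measure.hausdorffMeasure d (f '' S)
      ≤ Measure.hausdorffMeasure d (⋃ n, f '' (A n ∩ S)) := by
        refine measure_mono ?_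
        rw [← image_iUnion, ← iUnion_inter]
        exact image_mono fun p hp => ⟨hcover hp, hp⟩
    _ ≤ ∑' n, Measure.hausdorffMeasure d (f '' (A n ∩ S)) := measure_iUnion_le _
    _ ≤ ∑' n, (K : ℝ≥0∞) ^ d * Measure.hausdorffMeasure d (A n ∩ S) :=
        ENNReal.tsum_le_tsum fun n =>
          ((hlip (g n) (htS (mem_range_self n))).mono fun p hp =>
            interior_subset (disjointed_subset _ n hp.1)).hausdorffMeasure_image_le hd
    -- `S` need not be measurable; restricting the measure to `S` leaves additivity over the
    -- measurable `A n`.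
    _ = (K : ℝ≥0∞) ^ d * ((Measure.hausdorffMeasure d).restrict S) (⋃ n, A n) := by
        rw [ENNReal.tsum_mul_left, measure_iUnion (disjoint_disjointed _) hAm]
        congr 1
        exact tsum_congr fun n => (Measure.restrict_apply (hAm n)).symm
    _ ≤ (K : ℝ≥0∞) ^ d * Measure.hausdorffMeasure d S := by
        refine mul_le_mul_right ?_ _
        exact (measure_mono (subset_univ _)).trans_eq (Measure.restrict_apply_univ S)

/-- By inclusion-exclusion it suffices that a point of either frontier on the left lies in one of
those on the right, and a point of both lies in both. -/
lemma measure_frontier_inter_add_frontier_union_le {α : Type*} [TopologicalSpace α]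
    [MeasurableSpace α] [BorelSpace α] (μ : Measure α) {A B : Set α} (hA : IsOpen A)
    (hB : IsOpen B) :
    μ (frontier (A ∩ B)) + μ (frontier (A ∪ B)) ≤ μ (frontier A) + μ (frontier B) := by
  have hm : ∀ s : Set α, MeasurableSet (frontier s) := fun s => isClosed_frontier.measurableSet
  rw [← measure_union_add_inter (frontier (A ∩ B)) (hm (A ∪ B)),
    ← measure_union_add_inter (frontier A) (hm B)]
  have hA' := hA.frontier_eq
  have hB' := hB.frontier_eq
  have hAB := (hA.inter hB).frontier_eq
  have hAB' := (hA.union hB).frontier_eq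
  rw [closure_union] at hAB'
  have hc : closure (A ∩ B) ⊆ closure A ∩ closure B := closure_inter_subset_inter_closure A B
  gcongr μ ?_ + μ ?_
  · rintro p (hp | hp)
    · rw [hAB] at hp
      rw [hA', hB']
      have := hc hp.1
      by_cases h : p ∈ A
      · exact Or.inr ⟨this.2, fun h' => hp.2 ⟨h, h'⟩⟩
      · exact Or.inl ⟨this.1, h⟩
    · rw [hAB'] at hp
      rw [hA', hB']
      exact hp.1.imp (fun h => ⟨h, fun h' => hp.2 (Or.inl h')⟩)
        fun h => ⟨h, fun h' => hp.2 (Or.inr h')⟩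
  · rintro p ⟨hp, hq⟩
    rw [hAB] at hp
    rw [hAB'] at hq
    rw [hA', hB']
    have := hc hp.1
    exact ⟨⟨this.1, fun h' => hq.2 (Or.inl h')⟩, ⟨this.2, fun h' => hq.2 (Or.inr h')⟩⟩

/-- A projection `L` to the plane along a complement of `ker f'` is antilipschitz on the level set
near `x`, so the measure is controlled by that of a bounded planar set. -/
lemma exists_nhds_hausdorffMeasure_level_lt_top {f : E3 → ℝ} {f' : E3 →L[ℝ] ℝ} {x : E3}
    (hf : HasStrictFDerivAt f f' x) (hf' : f' ≠ 0) :
    ∃ V ∈ 𝓝 x, Measure.hausdorffMeasure 2 (V ∩ {y | f y = f x}) < ⊤ := by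
  have hrank : Module.finrank ℝ (LinearMap.ker (f' : E3 →ₗ[ℝ] ℝ)) =
      Module.finrank ℝ (Fin 2 → ℝ) := by
    have h := Module.Dual.finrank_ker_add_one_of_ne_zero (f := (f' : E3 →ₗ[ℝ] ℝ))
      (fun h => hf' (by ext v; exact congr($h v)))
    simp at h ⊢
    omega
  obtain ⟨g, hg⟩ := LinearMap.exists_leftInverse_of_injective
    (LinearMap.ker (f' : E3 →ₗ[ℝ] ℝ)).subtype (Submodule.ker_subtype _)
  set L : E3 →ₗ[ℝ] (Fin 2 → ℝ) := (LinearEquiv.ofFinrankEq _ _ hrank).toLinearMap ∘ₗ g with hL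
  have hinj : LinearMap.ker ((f' : E3 →ₗ[ℝ] ℝ).prod L) = ⊥ := by
    refine LinearMap.ker_eq_bot'.2 fun v hv => ?_
    have h1 : f' v = 0 := congr(($hv).1)
    have h2 : L v = 0 := congr(($hv).2)
    have h3 : g v = 0 := by simpa [hL] using h2
    have h4 : g v = ⟨v, h1⟩ := congr($hg ⟨v, h1⟩)
    rw [h3] at h4
    exact congr(($h4.symm : E3))
  obtain ⟨K, hK0, hK⟩ := LinearMap.exists_antilipschitzWith _ hinj
  -- With this constant, differences `w` of points of the level set satisfy `K * ‖f' w‖ ≤ ‖w‖ / 2`,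
  -- so in `‖w‖ ≤ K * max ‖f' w‖ ‖L w‖` only `L w` can matter.
  have hε : 0 < 1 / (2 * (K : ℝ)) := by positivity
  have hloc := hf.isLittleO.def hε
  rw [nhds_prod_eq] at hloc
  obtain ⟨V, hV, hVb⟩ := Filter.mem_prod_self_iff.1 hloc
  refine ⟨V ∩ Metric.ball x 1, inter_mem hV (Metric.ball_mem_nhds _ one_pos), ?_⟩
  set S := V ∩ Metric.ball x 1 ∩ {y | f y = f x} with hS
  have hanti : AntilipschitzWith K fun y : S => L y := by
    refine AntilipschitzWith.of_le_mul_dist fun y z => ?_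
    have h1 := hVb (mk_mem_prod y.2.1.1 z.2.1.1)
    have h2 := hK.le_mul_dist (y : E3) z
    have h3 : f y = f z := y.2.2.trans z.2.2.symm
    simp only [mem_ofPred_eq, h3, sub_self, zero_sub, norm_neg] at h1
    rw [dist_eq_norm, dist_eq_norm, ← map_sub] at h2
    rw [Subtype.dist_eq, dist_eq_norm, dist_eq_norm, ← map_sub]
    set w : E3 := (y : E3) - z
    have h4 : ‖((f' : E3 →ₗ[ℝ] ℝ).prod L) w‖ = max ‖f' w‖ ‖L w‖ := rfl
    rw [h4, mul_max_of_nonneg _ _ K.coe_nonneg] at h2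
    have h5 : (K : ℝ) * ‖f' w‖ ≤ ‖w‖ / 2 := by
      calc (K : ℝ) * ‖f' w‖ ≤ K * (1 / (2 * (K : ℝ)) * ‖w‖) := by gcongr
        _ = ‖w‖ / 2 := by
          have : (K : ℝ) ≠ 0 := by exact_mod_cast hK0.ne'
          field_simp
    rcases le_max_iff.1 h2 with h | h
    · have : ‖w‖ = 0 := by linarith [norm_nonneg w]
      rw [this]
      positivity
    · exact h
  have himg : Measure.hausdorffMeasure 2 S = Measure.hausdorffMeasure 2 (univ : Set S) := by
    have h := (isometry_subtype_coe (s := S)).hausdorffMeasure_image (d := 2)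
      (Or.inl zero_le_two) univ
    rwa [image_univ, Subtype.range_coe] at h
  rw [himg]
  refine (hanti.le_hausdorffMeasure_image zero_le_two univ).trans_lt ?_
  refine ENNReal.mul_lt_top (by simp) ?_
  have hvol := hausdorffMeasure_pi_real (ι := Fin 2)
  simp only [Fintype.card_fin, Nat.cast_ofNat] at hvol
  rw [hvol]
  refine Bornology.IsBounded.measure_lt_top ?_
  have h5 : (fun y : S => L y) '' univ = L '' S := by
    ext; simp
  rw [h5]
  have hb : Bornology.IsBounded S :=
    Metric.isBounded_ball.subset (inter_subset_left.trans inter_subset_right)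
  exact (LinearMap.toContinuousLinearMap L).lipschitz.isBounded_image hb

lemma hausdorffArea_eq {α : Type*} [EMetricSpace α] [MeasurableSpace α] [h : BorelSpace α]
    (S : Set α) :
    hausdorffArea S = ENNReal.ofReal (Real.pi / 4) * Measure.hausdorffMeasure 2 S := by
  obtain ⟨rfl⟩ := h
  rfl

lemma hausdorffArea_image_le {α β : Type*} [EMetricSpace α] [SecondCountableTopology α]
    [EMetricSpace β] {f : α → β} {S : Set α} {K : ℝ≥0}
    (h : ∀ p ∈ S, ∃ V ∈ 𝓝 p, LipschitzOnWith K f V) :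
    hausdorffArea (f '' S) ≤ (K : ℝ≥0∞) ^ 2 * hausdorffArea S := by
  borelize α
  borelize β
  rw [hausdorffArea_eq, hausdorffArea_eq, mul_left_comm]
  have := hausdorffMeasure_image_le_of_locally_lipschitz zero_le_two h
  gcongr
  simpa using this

lemma hausdorffArea_mono {α : Type*} [EMetricSpace α] {S T : Set α} (h : S ⊆ T) :
    hausdorffArea S ≤ hausdorffArea T := by
  borelize α
  rw [hausdorffArea_eq, hausdorffArea_eq]
  gcongr

lemma hausdorffArea_lt_top {α : Type*} [EMetricSpace α] {C : Set α} (hC : IsCompact C)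
    (h : ∀ p ∈ C, ∃ V ∈ 𝓝 p, hausdorffArea (V ∩ C) < ⊤) : hausdorffArea C < ⊤ := by
  borelize α
  simp only [hausdorffArea_eq, ENNReal.mul_lt_top_iff] at h ⊢
  have hpi : ENNReal.ofReal (Real.pi / 4) ≠ 0 := by simp [Real.pi_pos]
  refine Or.inl ⟨ENNReal.ofReal_lt_top, hC.measure_lt_top_of_nhdsWithin fun p hp => ?_⟩
  obtain ⟨V, hV, hlt⟩ := h p hp
  refine ⟨V ∩ C, inter_mem (mem_nhdsWithin_of_mem_nhds hV) self_mem_nhdsWithin, ?_⟩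
  rcases hlt with h | h | h
  · exact h.2
  · exact absurd h hpi
  · simp [h]

lemma hausdorffArea_frontier_inter_add_frontier_union_le {α : Type*} [EMetricSpace α]
    {A B : Set α} (hA : IsOpen A) (hB : IsOpen B) :
    hausdorffArea (frontier (A ∩ B)) + hausdorffArea (frontier (A ∪ B)) ≤
      hausdorffArea (frontier A) + hausdorffArea (frontier B) := by
  borelize α
  simp only [hausdorffArea_eq, ← mul_add]
  exact mul_le_mul_right (measure_frontier_inter_add_frontier_union_le _ hA hB) _

end Hausdorff

/-! ### Local Lipschitz bounds for Riemannian distances from a bound on one derivative. -/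

section Riemannian

open Manifold
open scoped NNReal

variable {E : Type*} [NormedAddCommGroup E] [NormedSpace ℝ E] [FiniteDimensional ℝ E]
  {H : Type*} [TopologicalSpace H] {I : ModelWithCorners ℝ E H}
  {M : Type*} [TopologicalSpace M] [ChartedSpace H M]
  [RiemannianBundle (fun p : M => TangentSpace I p)] [IsManifold I 1 M]
  [IsContinuousRiemannianBundle E (fun p : M => TangentSpace I p)]
  {E' : Type*} [NormedAddCommGroup E'] [NormedSpace ℝ E']
  {H' : Type*} [TopologicalSpace H'] {I' : ModelWithCorners ℝ E' H'}
  {N : Type*} [TopologicalSpace N] [ChartedSpace H' N]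
  [RiemannianBundle (fun p : N => TangentSpace I' p)] [IsManifold I' 1 N]
  [IsContinuousRiemannianBundle E' (fun p : N => TangentSpace I' p)]

omit [FiniteDimensional ℝ E] in
lemma continuous_norm_tangentBundle :
    Continuous fun v : TangentBundle I M => ‖(v.2 : TangentSpace I v.1)‖ := by
  have h : Continuous fun v : TangentBundle I M => Real.sqrt (inner ℝ v.2 v.2) :=
    Real.continuous_sqrt.comp (Continuous.inner_bundle (F := E)
      (E := fun p : M => TangentSpace I p) (b := fun v : TangentBundle I M => v.1)
      (v := fun v => v.2) (w := fun v => v.2) continuous_id continuous_id)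
  refine h.congr fun v => ?_
  rw [norm_eq_sqrt_real_inner]

/-- The strict inequality is open in the tangent bundle. In a trivialization the unit sphere is
compact, so the tube lemma carries the inequality to nearby fibres; homogeneity gives all vectors.
-/
lemma eventually_norm_mfderiv_le {φ : M → N} {U : Set M} (hU : IsOpen U)
    (hφ : ContMDiffOn I I' 1 φ U) {p : M} (hp : p ∈ U) {K : ℝ}
    (hK : ∀ v : TangentSpace I p, v ≠ 0 → ‖mfderiv I I' φ p v‖ < K * ‖v‖) :
    ∀ᶠ q in 𝓝 p, ∀ v : TangentSpace I q, ‖mfderiv I I' φ q v‖ ≤ K * ‖v‖ := by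
  set W : Set (TangentBundle I M) :=
    {v | v.1 ∈ U ∧ ‖mfderiv I I' φ v.1 v.2‖ < K * ‖(v.2 : TangentSpace I v.1)‖} with hW
  have hUo : IsOpen (TotalSpace.proj ⁻¹' U : Set (TangentBundle I M)) :=
    hU.preimage (FiberBundle.continuous_proj E (TangentSpace I))
  have hWo : IsOpen W := by
    have h1 : ContinuousOn (fun v : TangentBundle I M =>
        K * ‖(v.2 : TangentSpace I v.1)‖ - ‖mfderiv I I' φ v.1 v.2‖) (TotalSpace.proj ⁻¹' U) := by
      refine (continuous_const.mul continuous_norm_tangentBundle).continuousOn.sub ?_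
      refine (continuous_norm_tangentBundle.comp_continuousOn
        (hφ.continuousOn_tangentMapWithin le_rfl hU.uniqueMDiffOn)).congr fun v hv => ?_
      simp only [tangentMapWithin, Function.comp_apply, mfderivWithin_of_isOpen hU hv]
      rfl
    have h2 := h1.isOpen_inter_preimage hUo (isOpen_Ioi (a := (0 : ℝ)))
    convert h2 using 1
    ext v
    simp [hW]
  let e := trivializationAt E (TangentSpace I) p
  have hpe : p ∈ e.baseSet := mem_baseSet_trivializationAt E (TangentSpace I) p
  have hTo := e.toOpenPartialHomeomorph.isOpen_inter_preimage_symm hWo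
  have hsymm : ∀ q ∈ e.baseSet, ∀ w : E,
      e.toOpenPartialHomeomorph.symm (q, w) = (⟨q, e.symmL ℝ q w⟩ : TangentBundle I M) :=
    fun q hq w => by rw [← e.mk_symm hq w, e.symmL_apply]; exact hq
  obtain ⟨u, s, huo, -, hpu, hs, hus⟩ := generalized_tube_lemma (isCompact_singleton (x := p))
    (isCompact_sphere (0 : E) 1) hTo (by
      rintro ⟨q, w⟩ ⟨rfl, hw⟩
      refine ⟨e.mem_target.2 hpe, ?_⟩
      rw [mem_preimage, hsymm _ hpe]
      refine ⟨hp, hK _ fun h0 => ?_⟩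
      have h := e.continuousLinearMapAt_symmL (R := ℝ) hpe w
      change e.symmL ℝ q w = 0 at h0
      rw [h0, map_zero] at h
      simp [← h] at hw)
  filter_upwards [huo.mem_nhds (hpu rfl), e.open_baseSet.mem_nhds hpe] with q hq hqe v
  rcases eq_or_ne v 0 with rfl | hv
  · simp
  set a : E := e.continuousLinearMapAt ℝ q v with ha
  have hva : e.symmL ℝ q a = v := e.symmL_continuousLinearMapAt hqe v
  have ha0 : a ≠ 0 := fun h => hv (by rw [← hva, h, map_zero])
  have hmem : (q, ‖a‖⁻¹ • a) ∈ u ×ˢ s := ⟨hq, hs (by simp [norm_smul, ha0])⟩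
  have h := (hus hmem).2
  rw [mem_preimage, hsymm _ hqe, map_smul, hva] at h
  have h' := h.2
  simp only [map_smul, norm_smul, norm_inv, norm_norm] at h'
  have hpos : 0 < ‖a‖⁻¹ := inv_pos.2 (norm_pos_iff.2 ha0)
  refine le_of_mul_le_mul_left ?_ hpos
  linarith

/-- Almost shortest curves between points near `p` stay where the derivative is bounded by `K`; `φ`
stretches their lengths by at most `K`. -/
lemma exists_lipschitz_riemannianEDist [RegularSpace M] {φ : M → N} {U : Set M} (hU : IsOpen U)
    (hφ : ContMDiffOn I I' 1 φ U) {p : M} (hp : p ∈ U) {K : ℝ≥0}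
    (hK : ∀ v : TangentSpace I p, v ≠ 0 → ‖mfderiv I I' φ p v‖ < K * ‖v‖) :
    ∃ V ∈ 𝓝 p, ∀ x ∈ V, ∀ y ∈ V,
      riemannianEDist I' (φ x) (φ y) ≤ K * riemannianEDist I x y := by
  obtain ⟨c, hc0, hc⟩ := setOfPred_riemannianEDist_lt_subset_nhds' I
    (inter_mem (hU.mem_nhds hp) (eventually_norm_mfderiv_le hU hφ hp hK))
  -- Points of the `c / 3`-ball are less than `2c / 3` apart, so a curve of such length between them
  -- stays in the `c`-ball.
  have hc3 : 0 < c / 3 := ENNReal.div_pos hc0.ne' (by simp)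
  refine ⟨_, eventually_riemannianEDist_lt I p hc3, fun x hx y hy => ?_⟩
  have hxy : riemannianEDist I x y < c / 3 + c / 3 :=
    riemannianEDist_triangle.trans_lt
      (ENNReal.add_lt_add (riemannianEDist_comm.trans_lt hx) hy)
  have key : ∀ r, riemannianEDist I x y < r → riemannianEDist I' (φ x) (φ y) ≤ K * r := by
    intro r hr
    obtain ⟨γ, h0, h1, hγ, hlen⟩ := exists_lt_of_riemannianEDist_lt (lt_min hr hxy)
    have hmem : ∀ t ∈ Icc (0 : ℝ) 1, γ t ∈ U ∧
        ∀ v : TangentSpace I (γ t), ‖mfderiv I I' φ (γ t) v‖ ≤ K * ‖v‖ := by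
      intro t ht
      refine hc ?_
      have h2 : riemannianEDist I x (γ t) ≤ pathELength I γ 0 t :=
        riemannianEDist_le_pathELength (hγ.mono (Icc_subset_Icc_right ht.2)) h0 rfl ht.1
      have h3 : riemannianEDist I x (γ t) < c / 3 + c / 3 :=
        (h2.trans (pathELength_mono le_rfl ht.2)).trans_lt (hlen.trans_le (min_le_right _ _))
      calc riemannianEDist I p (γ t) ≤ riemannianEDist I p x + riemannianEDist I x (γ t) :=
            riemannianEDist_triangle
        _ < c / 3 + (c / 3 + c / 3) := ENNReal.add_lt_add hx h3
        _ = c := by rw [← add_assoc, ENNReal.add_thirds]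
    have hmaps : Icc (0 : ℝ) 1 ⊆ γ ⁻¹' U := fun t ht => (hmem t ht).1
    have h4 : riemannianEDist I' (φ x) (φ y) ≤ pathELength I' (φ ∘ γ) 0 1 :=
      riemannianEDist_le_pathELength (hφ.comp hγ hmaps) (by simp [h0]) (by simp [h1]) zero_le_one
    refine h4.trans ?_
    have h5 : pathELength I' (φ ∘ γ) 0 1 ≤ K * pathELength I γ 0 1 := by
      rw [pathELength_eq_lintegral_mfderivWithin_Icc, pathELength_eq_lintegral_mfderivWithin_Icc,
        ← lintegral_const_mul' _ _ ENNReal.coe_ne_top]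
      refine setLIntegral_mono' measurableSet_Icc fun t ht => ?_
      have h6 : mfderivWithin 𝓘(ℝ, ℝ) I' (φ ∘ γ) (Icc 0 1) t =
          (mfderiv I I' φ (γ t)) ∘L (mfderivWithin 𝓘(ℝ, ℝ) I γ (Icc 0 1) t) := by
        apply mfderiv_comp_mfderivWithin
        · exact (hφ.contMDiffAt (hU.mem_nhds (hmaps ht))).mdifferentiableAt one_ne_zero
        · exact hγ.mdifferentiableOn one_ne_zero t ht
        · rw [uniqueMDiffWithinAt_iff_uniqueDiffWithinAt]
          exact uniqueDiffOn_Icc zero_lt_one t ht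
      have h7 : mfderivWithin 𝓘(ℝ, ℝ) I' (φ ∘ γ) (Icc 0 1) t 1 =
          mfderiv I I' φ (γ t) (mfderivWithin 𝓘(ℝ, ℝ) I γ (Icc 0 1) t 1) := congr($h6 1)
      rw [h7]
      have h8 := (hmem t ht).2 (mfderivWithin 𝓘(ℝ, ℝ) I γ (Icc 0 1) t 1)
      simp only [enorm, ← ENNReal.coe_mul, ENNReal.coe_le_coe]
      exact_mod_cast h8
    refine h5.trans ?_
    gcongr
    exact hlen.le.trans (min_le_left _ _)
  by_contra! hlt
  rcases eq_or_ne K 0 with rfl | hK0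
  -- Here `r = ⊤`, and `0 * ⊤ = 0`.
  · have := key _ (lt_of_lt_of_le hxy le_top)
    simp at this hlt
    exact hlt.ne' this
  have hK0' : (K : ℝ≥0∞) ≠ 0 := by exact_mod_cast hK0
  have hlt' : riemannianEDist I x y < riemannianEDist I' (φ x) (φ y) / K := by
    rw [ENNReal.lt_div_iff_mul_lt (Or.inl hK0') (Or.inl ENNReal.coe_ne_top), mul_comm]
    exact hlt
  obtain ⟨r, hr1, hr2⟩ := exists_between hlt'
  rw [ENNReal.lt_div_iff_mul_lt (Or.inl hK0') (Or.inl ENNReal.coe_ne_top), mul_comm] at hr2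
  exact (key r hr1).not_gt hr2

end Riemannian

/-! ### Area of Cauchy data: invariance under identifications, finiteness for smooth boundaries. -/

namespace CauchyData

open Manifold
open scoped NNReal

/-- The inner products of the metric on the tangent spaces. -/
@[reducible] noncomputable def riemannianBundle (X : CauchyData.{u}) :
    RiemannianBundle (fun p : X.carrier => TangentSpace (𝓡 3) p) :=
  ⟨X.g.toRiemannianMetric⟩

attribute [local instance] riemannianBundle

instance (X : CauchyData.{u}) :
    IsContinuousRiemannianBundle E3 (fun p : X.carrier => TangentSpace (𝓡 3) p) :=
  ⟨X.g.inner, X.g.contMDiff.continuous, fun _ _ _ => rfl⟩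

instance (X : CauchyData.{u}) : IsManifold (𝓡 3) 1 X.carrier :=
  IsManifold.of_le (n := ∞) (by exact_mod_cast le_top)

instance (X : CauchyData.{u}) : LocallyCompactSpace X.carrier :=
  ChartedSpace.locallyCompactSpace E3 X.carrier

lemma norm_eq_sqrt_inner (X : CauchyData.{u}) {p : X.carrier} (v : TangentSpace (𝓡 3) p) :
    ‖v‖ = Real.sqrt (X.g.inner p v v) := by
  rw [norm_eq_sqrt_real_inner]
  rfl

lemma area_image_le {X Y : CauchyData.{u}} {f : X.carrier → Y.carrier} {S : Set X.carrier}
    {K : ℝ≥0} (h : ∀ p ∈ S, ∃ V ∈ 𝓝 p, ∀ x ∈ V, ∀ y ∈ V,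
      riemannianEDist (𝓡 3) (f x) (f y) ≤ K * riemannianEDist (𝓡 3) x y) :
    Y.area (f '' S) ≤ (K : ℝ≥0∞) ^ 2 * X.area S :=
  -- The extended distance of `X.distance` is `riemannianEDist` by definition.
  @hausdorffArea_image_le X.carrier Y.carrier X.distance X.secondCountable Y.distance f S K
    fun p hp => (h p hp).imp fun _ hV => ⟨hV.1, fun x hx y hy => hV.2 x hx y hy⟩

lemma area_frontier_inter_add_frontier_union_le (X : CauchyData.{u}) {A B : Set X.carrier}
    (hA : IsOpen A) (hB : IsOpen B) :
    X.area (frontier (A ∩ B)) + X.area (frontier (A ∪ B)) ≤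
      X.area (frontier A) + X.area (frontier B) :=
  @hausdorffArea_frontier_inter_add_frontier_union_le X.carrier X.distance A B hA hB

lemma area_mono (X : CauchyData.{u}) {S T : Set X.carrier} (h : S ⊆ T) : X.area S ≤ X.area T :=
  @hausdorffArea_mono X.carrier X.distance S T h

lemma area_lt_top_of_isCompact (X : CauchyData.{u}) {C : Set X.carrier} (hC : IsCompact C)
    (h : ∀ p ∈ C, ∃ V ∈ 𝓝 p, X.area (V ∩ C) < ⊤) : X.area C < ⊤ :=
  @hausdorffArea_lt_top X.carrier X.distance C hC h

variable {X Y : CauchyData.{u}} {φ : OpenPartialHomeomorph X.carrier Y.carrier}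
  {C : Set X.carrier}

lemma IdentifiesOn.mono {C' : Set X.carrier} (h : X.IdentifiesOn Y φ C) (hC : C' ⊆ C) :
    X.IdentifiesOn Y φ C' :=
  ⟨hC.trans h.subset_source, h.contMDiffOn, h.contMDiffOn_symm,
    fun p hp => h.metric_eq p (hC hp), fun p hp => h.form_eq p (hC hp)⟩

lemma IdentifiesOn.symm (h : X.IdentifiesOn Y φ C) : Y.IdentifiesOn X φ.symm (φ '' C) := by
  have hd : φ.MDifferentiable (𝓡 3) (𝓡 3) :=
    ⟨h.contMDiffOn.mdifferentiableOn (by simp), h.contMDiffOn_symm.mdifferentiableOn (by simp)⟩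
  have hsub : φ '' C ⊆ φ.target := by
    rintro _ ⟨p, hp, rfl⟩
    exact φ.map_source (h.subset_source hp)
  have hmem : ∀ q ∈ φ '' C, φ.symm q ∈ C := by
    rintro _ ⟨p, hp, rfl⟩
    rwa [φ.left_inv (h.subset_source hp)]
  have hinv : ∀ q ∈ φ '' C, ∀ v : TangentSpace (𝓡 3) q,
      mfderiv (𝓡 3) (𝓡 3) φ (φ.symm q) (mfderiv (𝓡 3) (𝓡 3) φ.symm q v) = v :=
    fun q hq v => congr($(hd.comp_symm_deriv (hsub hq)) v)
  -- Tangent spaces at `φ (φ.symm q)` and `q` both unfold to `E3`, which allows changing the base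
  -- point without a cast.
  have hg : ∀ q r : Y.carrier, q = r → ∀ v w : E3, Y.g.inner q v w = Y.g.inner r v w := by
    rintro q _ rfl v w
    rfl
  have hh : ∀ q r : Y.carrier, q = r → ∀ v w : E3, Y.h q v w = Y.h r v w := by
    rintro q _ rfl v w
    rfl
  refine ⟨hsub, h.contMDiffOn_symm, by simpa using h.contMDiffOn, fun q hq v w => ?_,
    fun q hq v w => ?_⟩
  · rw [← h.metric_eq _ (hmem q hq)]
    exact (hg _ _ (φ.right_inv (hsub hq)) _ _).trans
      (congrArg₂ (fun a b : E3 => Y.g.inner q a b) (hinv q hq v) (hinv q hq w))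
  · rw [← h.form_eq _ (hmem q hq)]
    exact (hh _ _ (φ.right_inv (hsub hq)) _ _).trans
      (congrArg₂ (fun a b : E3 => Y.h q a b) (hinv q hq v) (hinv q hq w))

/-- Off `C` the map need not be isometric, but its derivative is so at each point of `S`. Hence it
is `K`-Lipschitz near that point for every `K > 1`; let `K → 1`. -/
lemma IdentifiesOn.area_image_le (h : X.IdentifiesOn Y φ C) {S : Set X.carrier} (hS : S ⊆ C) :
    Y.area (φ '' S) ≤ X.area S := by
  have key : ∀ K : ℝ≥0, 1 < K → Y.area (φ '' S) ≤ (K : ℝ≥0∞) ^ 2 * X.area S := by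
    intro K hK
    refine CauchyData.area_image_le fun p hp => ?_
    refine exists_lipschitz_riemannianEDist φ.open_source
      (h.contMDiffOn.of_le (by exact_mod_cast le_top)) (h.subset_source (hS hp)) fun v hv => ?_
    rw [norm_eq_sqrt_inner, norm_eq_sqrt_inner, h.metric_eq p (hS hp)]
    have hpos : 0 < Real.sqrt (X.g.inner p v v) := Real.sqrt_pos.2 (X.g.pos p v hv)
    have hK' : (1 : ℝ) < K := by exact_mod_cast hK
    nlinarith
  rcases eq_or_ne (X.area S) ⊤ with htop | htop
  · simp [htop]
  have hlim : Tendsto (fun K : ℝ≥0 => (K : ℝ≥0∞) ^ 2 * X.area S) (𝓝[>] 1)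
      (𝓝 (((1 : ℝ≥0) : ℝ≥0∞) ^ 2 * X.area S)) := by
    refine Tendsto.mono_left ?_ nhdsWithin_le_nhds
    refine ENNReal.Tendsto.mul_const ?_ (Or.inr htop)
    exact ((ENNReal.continuous_pow 2).comp ENNReal.continuous_coe).tendsto 1
  have := ge_of_tendsto hlim (eventually_nhdsWithin_of_forall fun K hK => key K hK)
  simpa using this

lemma IdentifiesOn.area_image (h : X.IdentifiesOn Y φ C) {S : Set X.carrier} (hS : S ⊆ C) :
    Y.area (φ '' S) = X.area S := by
  refine le_antisymm (h.area_image_le hS) ?_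
  have h1 := h.symm.area_image_le (image_mono hS)
  have h2 : φ.symm '' (φ '' S) = S :=
    φ.toPartialEquiv.symm_image_image_of_subset_source (hS.trans h.subset_source)
  rwa [h2] at h1

/-- By compactness the question is local. In a chart the boundary lies in a regular level set, and
the inverse chart is locally Lipschitz from the Euclidean to the Riemannian distance. -/
lemma area_frontier_lt_top {D : Set X.carrier} (hD : IsOpen D) (hs : X.HasSmoothBoundary D)
    (hc : IsCompact (frontier D)) : X.area (frontier D) < ⊤ := by
  refine X.area_lt_top_of_isCompact hc fun p hp => ?_
  obtain ⟨U, f, hU, hpU, hf, hdf, hDf⟩ := hs p hp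
  have hzero : ∀ q ∈ U, q ∈ frontier D → f q = 0 := by
    intro q hq hqD
    rw [hD.frontier_eq] at hqD
    have h0 : 0 ≤ f q := not_lt.1 fun h => hqD.2 ((hDf q hq).2 h)
    refine le_antisymm (not_lt.1 fun h => ?_) h0
    have hcont : ContinuousAt f q := hf.continuousOn.continuousAt (hU.mem_nhds hq)
    obtain ⟨r, ⟨hr, hrU⟩, hrD⟩ := mem_closure_iff_nhds.1 hqD.1 _
      (inter_mem (hcont.eventually (lt_mem_nhds h)) (hU.mem_nhds hq))
    exact lt_asymm hr ((hDf r hrU).1 hrD)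
  set c := chartAt E3 p with hc
  have hps : p ∈ c.source := mem_chart_source E3 p
  have hpt : c p ∈ c.target := c.map_source hps
  have hcs : ContMDiffOn (𝓡 3) (𝓡 3) ∞ c.symm c.target := contMDiffOn_chart_symm
  have hpp : c.symm (c p) = p := c.left_inv hps
  have hfp : ContMDiffAt (𝓡 3) 𝓘(ℝ, ℝ) ∞ f p := hf.contMDiffAt (hU.mem_nhds hpU)
  have hF : ContMDiffAt (𝓡 3) 𝓘(ℝ, ℝ) ∞ (f ∘ c.symm) (c p) :=
    ContMDiffAt.comp (c p) (by rwa [hpp]) (hcs.contMDiffAt (c.open_target.mem_nhds hpt))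
  have hF' : HasStrictFDerivAt (f ∘ c.symm) (fderiv ℝ (f ∘ c.symm) (c p)) (c p) :=
    hF.contDiffAt.hasStrictFDerivAt (by simp)
  have hF0 : fderiv ℝ (f ∘ c.symm) (c p) ≠ 0 := by
    intro h0
    refine hdf ?_
    have h1 : f =ᶠ[𝓝 p] (f ∘ c.symm) ∘ c := by
      filter_upwards [c.open_source.mem_nhds hps] with q hq
      simp [c.left_inv hq]
    have h2 : MDifferentiableAt (𝓡 3) (𝓡 3) c p :=
      (contMDiffOn_chart (n := ∞).contMDiffAt (c.open_source.mem_nhds hps)).mdifferentiableAt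
        (by simp)
    rw [h1.mfderiv_eq, mfderiv_comp p (hF.mdifferentiableAt (by simp)) h2, mfderiv_eq_fderiv, h0]
    rfl
  obtain ⟨V, hV, hVlt⟩ := exists_nhds_hausdorffMeasure_level_lt_top hF' hF0
  set A := mfderiv (𝓡 3) (𝓡 3) c.symm (c p) with hA
  have : IsContinuousRiemannianBundle E3 (fun p : E3 => TangentSpace (𝓡 3) p) :=
    ⟨(riemannianMetricVectorSpace E3).inner, (riemannianMetricVectorSpace E3).contMDiff.continuous,
      fun _ _ _ => rfl⟩
  -- The `+ 1` makes the bound on the derivative strict.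
  obtain ⟨W, hW, hlip⟩ := exists_lipschitz_riemannianEDist (K := ‖A‖₊ + 1) c.open_target
    (hcs.of_le (by exact_mod_cast le_top)) hpt fun v hv => by
      have h1 := A.le_opNorm v
      have h2 := norm_pos_iff.2 hv
      push_cast
      linarith
  set T := interior W ∩ (V ∩ {y | (f ∘ c.symm) y = (f ∘ c.symm) (c p)}) with hT
  have hTlt : hausdorffArea T < ⊤ := by
    rw [hausdorffArea_eq]
    exact ENNReal.mul_lt_top ENNReal.ofReal_lt_top ((measure_mono inter_subset_right).trans_lt hVlt)
  have himg : X.area (c.symm '' T) < ⊤ := by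
    refine lt_of_le_of_lt (@hausdorffArea_image_le E3 X.carrier _ _ X.distance c.symm T
      (‖A‖₊ + 1) fun y hy => ⟨interior W, isOpen_interior.mem_nhds hy.1, ?_⟩)
      (ENNReal.mul_lt_top (by simp) hTlt)
    intro y hy z hz
    rw [IsRiemannianManifold.out (I := 𝓡 3) y z]
    exact hlip y (interior_subset hy) z (interior_subset hz)
  refine ⟨c.source ∩ c ⁻¹' (interior W ∩ V) ∩ U, inter_mem (inter_mem
    (c.open_source.mem_nhds hps) ((c.continuousAt hps).preimage_mem_nhds
      (inter_mem (interior_mem_nhds.2 hW) hV))) (hU.mem_nhds hpU),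
    (X.area_mono ?_).trans_lt himg⟩
  rintro q ⟨⟨⟨hq, hqW, hqV⟩, hqU⟩, hqD⟩
  refine ⟨c q, ⟨hqW, hqV, ?_⟩, c.left_inv hq⟩
  simp [c.left_inv hq, hpp, hzero q hqU hqD, hzero p hpU hp]

end CauchyData

/-! ### Closures and frontiers under partial homeomorphisms. -/

/-- Since `B` and its image are both closed, limit points cannot escape from the source or the
target. -/
lemma OpenPartialHomeomorph.image_closure_eq {α β : Type*} [TopologicalSpace α]
    [TopologicalSpace β] (φ : OpenPartialHomeomorph α β) {A B : Set α} (hA : A ⊆ B)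
    (hB : B ⊆ φ.source) (hBc : IsClosed B) (hBi : IsClosed (φ '' B)) :
    φ '' closure A = closure (φ '' A) := by
  have hAB : closure A ⊆ B := closure_minimal hA hBc
  refine subset_antisymm ?_ fun q hq => ?_
  · rintro _ ⟨p, hp, rfl⟩
    exact mem_closure_image (φ.continuousAt (hB (hAB hp))) hp
  · obtain ⟨p, hp, rfl⟩ := closure_minimal (image_mono hA) hBi hq
    refine ⟨p, ?_, rfl⟩
    have h := mem_closure_image (φ.symm.continuousAt (φ.map_source (hB hp))) hq
    have h2 : φ.symm '' (φ '' A) = A :=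
      φ.toPartialEquiv.symm_image_image_of_subset_source (hA.trans hB)
    rwa [h2, φ.left_inv (hB hp)] at h

lemma OpenPartialHomeomorph.image_frontier_eq {α β : Type*} [TopologicalSpace α]
    [TopologicalSpace β] (φ : OpenPartialHomeomorph α β) {A B : Set α} (hAo : IsOpen A)
    (hA : A ⊆ B) (hB : B ⊆ φ.source) (hBc : IsClosed B) (hBi : IsClosed (φ '' B)) :
    φ '' frontier A = frontier (φ '' A) := by
  have hAB : closure A ⊆ B := closure_minimal hA hBc
  rw [hAo.frontier_eq, (φ.isOpen_image_of_subset_source hAo (hA.trans hB)).frontier_eq,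
    ← φ.image_closure_eq hA hB hBc hBi]
  exact (φ.injOn.mono (hAB.trans hB)).image_sdiff_subset subset_closure

/-! ### Regions, and the transfer of fill-ins and extensions. -/

namespace CauchyData

variable {X Y : CauchyData.{u}} {e : OpenPartialHomeomorph X.carrier E3}
  {e' : OpenPartialHomeomorph Y.carrier E3} {D D₁ D₂ : Set X.carrier} {D' : Set Y.carrier}

lemma isOpen_farEnd (X : CauchyData.{u}) (e : OpenPartialHomeomorph X.carrier E3) (r : ℝ) :
    IsOpen (X.farEnd e r) :=
  e.isOpen_inter_preimage (isOpen_lt continuous_const continuous_norm)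

lemma farEnd_anti (X : CauchyData.{u}) (e : OpenPartialHomeomorph X.carrier E3) {r s : ℝ}
    (h : r ≤ s) : X.farEnd e s ⊆ X.farEnd e r :=
  fun _ hp => ⟨hp.1, h.trans_lt hp.2⟩

lemma IsAsymptoticallyFlat.isAsymptoticallyFlatEnd (h : X.IsAsymptoticallyFlat e) :
    X.IsAsymptoticallyFlatEnd e := by
  obtain ⟨n, c, rfl, hc, -⟩ := h
  exact hc 0

/-- Raising the radius adds only a part of the shell `r < |x| ≤ s` of the chosen end; it misses the
other ends, so it lies in a compact set. Several regions can thus share one radius. -/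
lemma IsAsymptoticallyFlat.isCompact_compl (h : X.IsAsymptoticallyFlat e) (hD : IsOpen D)
    {r s : ℝ} (hr : 1 ≤ r) (hrs : r ≤ s) (hc : IsCompact (D ∪ X.farEnd e r)ᶜ) :
    IsCompact (D ∪ X.farEnd e s)ᶜ := by
  obtain ⟨n, c, rfl, -, hdisj, hcomp⟩ := h
  refine (hc.union (hcomp s (hr.trans hrs))).of_isClosed_subset
    (hD.union (X.isOpen_farEnd _ s)).isClosed_compl fun p hp => ?_
  by_cases hpr : p ∈ X.farEnd (c 0) r
  · refine Or.inr fun hmem => ?_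
    obtain ⟨i, hi⟩ := mem_iUnion.1 hmem
    by_cases h0 : i = 0
    · exact hp (Or.inr (h0 ▸ hi))
    · exact disjoint_left.1 (hdisj i 0 h0) hi.1 hpr.1
  · exact Or.inl fun h => h.elim (fun h => hp (Or.inl h)) hpr

lemma IsRegion.exists_forall_ge (hD : X.IsRegion e D) (h : X.IsAsymptoticallyFlat e) :
    ∃ r : ℝ, 1 ≤ r ∧ ∀ s, r ≤ s → Disjoint D (X.farEnd e s) ∧ IsCompact (D ∪ X.farEnd e s)ᶜ := by
  obtain ⟨hDo, r, hr, hdisj, hc⟩ := hD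
  exact ⟨r, hr, fun s hs => ⟨hdisj.mono_right (X.farEnd_anti e hs),
    h.isCompact_compl hDo hr hs hc⟩⟩

lemma IsAsymptoticallyFlatEnd.exists_disjoint_farEnd (h : X.IsAsymptoticallyFlatEnd e)
    {L : Set X.carrier} (hL : IsCompact L) : ∃ r : ℝ, ∀ s, r ≤ s → Disjoint L (X.farEnd e s) := by
  -- Any radius above `1` would do; closedness makes the set compact, so `‖e p‖` is bounded on it.
  have hc := hL.inter_right (h.closed_far 2 one_lt_two)
  have hcont : ContinuousOn (fun p => ‖e p‖) (L ∩ {p | p ∈ e.source ∧ 2 ≤ ‖e p‖}) :=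
    (e.continuousOn.mono fun p hp => hp.2.1).norm
  obtain ⟨B, hB⟩ := (hc.image_of_continuousOn hcont).bddAbove
  refine ⟨max B 2, fun s hs => disjoint_left.2 fun p hp hps => ?_⟩
  have h2 : 2 ≤ ‖e p‖ := ((le_max_right _ _).trans hs).trans hps.2.le
  have h3 : ‖e p‖ ≤ B := hB ⟨p, ⟨hp, hps.1, h2⟩, rfl⟩
  exact (hps.2.trans_le (h3.trans ((le_max_left _ _).trans hs))).false

/-- This keeps the image of `D₂ \ D₁` in a compact set of the new data; `K` avoids `D₁`, where a
fill-in provides no map. -/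
lemma IsRegion.exists_isCompact_diff_subset (hD₁ : X.IsRegion e D₁) (hD₂ : X.IsRegion e D₂)
    (h : X.IsAsymptoticallyFlat e) : ∃ K, IsCompact K ∧ Disjoint K D₁ ∧ D₂ \ D₁ ⊆ K := by
  obtain ⟨r, -, hr⟩ := hD₁.exists_forall_ge h
  obtain ⟨s, -, hs⟩ := hD₂.exists_forall_ge h
  refine ⟨_, (hr (max r s) (le_max_left _ _)).2,
    disjoint_left.2 fun p hp hp₁ => hp (Or.inl hp₁), fun p hp hmem => ?_⟩
  exact hmem.elim hp.2 (disjoint_left.1 (hs (max r s) (le_max_right _ _)).1 hp.1)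

lemma IsRegion.isCompact_frontier (hD : X.IsRegion e D) : IsCompact (frontier D) := by
  obtain ⟨hDo, r, -, hdisj, hc⟩ := hD
  refine hc.of_isClosed_subset isClosed_frontier fun p hp hmem => ?_
  rw [hDo.frontier_eq] at hp
  exact hmem.elim hp.2 (disjoint_left.1 (hdisj.closure_left (X.isOpen_farEnd e r)) hp.1)

lemma IsRegion.union (hD₁ : X.IsRegion e D₁) (hD₂ : X.IsRegion e D₂)
    (h : X.IsAsymptoticallyFlat e) : X.IsRegion e (D₁ ∪ D₂) := by
  obtain ⟨r, hr1, hr⟩ := hD₁.exists_forall_ge h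
  obtain ⟨s, -, hs⟩ := hD₂.exists_forall_ge h
  have hr' := hr (max r s) (le_max_left _ _)
  have hs' := hs (max r s) (le_max_right _ _)
  refine ⟨hD₁.1.union hD₂.1, max r s, hr1.trans (le_max_left _ _), hr'.1.union_left hs'.1,
    hr'.2.of_isClosed_subset
      ((hD₁.1.union hD₂.1).union (X.isOpen_farEnd e _)).isClosed_compl
      (compl_subset_compl.2 (union_subset_union_left _ subset_union_left))⟩

/-- An open set between two regions is a region. -/
lemma IsRegion.of_subset_of_subset (hD₁ : X.IsRegion e D₁) (hD₂ : X.IsRegion e D₂)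
    (h : X.IsAsymptoticallyFlat e) (hD : IsOpen D) (h₁ : D₁ ⊆ D) (h₂ : D ⊆ D₂) :
    X.IsRegion e D := by
  obtain ⟨r, hr1, hr⟩ := hD₁.exists_forall_ge h
  obtain ⟨s, -, hs⟩ := hD₂.exists_forall_ge h
  have hr' := hr (max r s) (le_max_left _ _)
  have hs' := hs (max r s) (le_max_right _ _)
  exact ⟨hD, max r s, hr1.trans (le_max_left _ _), hs'.1.mono_left h₂,
    hr'.2.of_isClosed_subset (hD.union (X.isOpen_farEnd e _)).isClosed_compl
      (compl_subset_compl.2 (union_subset_union_left _ h₁))⟩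

lemma IsFillIn.exists_of_subset (hf : X.IsFillIn D₁ Y e' D') (h : X.IsAsymptoticallyFlat e)
    (hD₁ : X.IsRegion e D₁) (hD₂ : X.IsRegion e D₂) (hsub : D₁ ⊆ D₂) :
    ∃ D'₂, X.IsFillIn D₂ Y e' D'₂ := by
  obtain ⟨hadm, hD', φ, hφ, himg⟩ := hf
  have hflat := hadm.asymptoticallyFlat
  have hcl : IsClosed (φ '' D₂ᶜ) := by
    have := φ.image_closure_eq (compl_subset_compl.2 hsub) hφ.subset_source hD₁.1.isClosed_compl
      (himg ▸ hD'.1.isClosed_compl)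
    rw [hD₂.1.isClosed_compl.closure_eq] at this
    exact this ▸ isClosed_closure
  refine ⟨(φ '' D₂ᶜ)ᶜ, hadm, ?_, φ, hφ.mono (compl_subset_compl.2 hsub), (compl_compl _).symm⟩
  obtain ⟨K, hK, hKD, hdiff⟩ := hD₁.exists_isCompact_diff_subset hD₂ h
  have hKs : K ⊆ φ.source := fun p hp => hφ.subset_source (disjoint_left.1 hKD hp)
  -- The new inside is covered by `D'` and the compact image of `K`, so it stays away from infinity
  -- in `e'`.
  obtain ⟨r, hr⟩ := hflat.isAsymptoticallyFlatEnd.exists_disjoint_farEnd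
    (hK.image_of_continuousOn (φ.continuousOn.mono hKs))
  obtain ⟨s, hs1, hs⟩ := hD'.exists_forall_ge hflat
  have hs' := hs (max r s) (le_max_right _ _)
  refine ⟨hcl.isOpen_compl, max r s, hs1.trans (le_max_right _ _), ?_,
    hs'.2.of_isClosed_subset (hcl.isOpen_compl.union (Y.isOpen_farEnd e' _)).isClosed_compl
      (compl_subset_compl.2 (union_subset_union_left _ ?_))⟩
  · refine (hs'.1.union_left (hr (max r s) (le_max_left _ _))).mono_left fun q hq => ?_
    by_cases hqD : q ∈ D'
    · exact Or.inl hqD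
    · have hq' : q ∈ φ '' D₁ᶜ := himg ▸ hqD
      obtain ⟨p, hp, rfl⟩ := hq'
      exact Or.inr ⟨p, hdiff ⟨not_not.1 fun h2 => hq ⟨p, h2, rfl⟩, hp⟩, rfl⟩
  · refine subset_compl_comm.1 ?_
    rw [← himg]
    exact image_mono (compl_subset_compl.2 hsub)

lemma IsExtension.image_of_subset (hX : X.IsExtension D₂ Y e' D') (h : X.IsAsymptoticallyFlat e)
    (hD₁ : X.IsRegion e D₁) (hD₂ : X.IsRegion e D₂) (hs₂ : X.HasSmoothBoundary D₂)
    (hsub : D₁ ⊆ D₂) (hmin₁ : X.IsOuterMinimising e D₁) (hmin' : Y.IsOuterMinimising e' D') :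
    ∃ D'₁, X.IsExtension D₁ Y e' D'₁ ∧ Y.IsOuterMinimising e' D'₁ := by
  obtain ⟨hadm, hD', φ, hφ, himg, himgc⟩ := hX
  have hflat := hadm.asymptoticallyFlat
  have hci : IsClosed (φ '' closure D₂) := himgc ▸ isClosed_closure
  have hsub' : closure D₁ ⊆ closure D₂ := closure_mono hsub
  have hD₁s : D₁ ⊆ φ.source := (subset_closure.trans hsub').trans hφ.subset_source
  have hfr : ∀ F : Set X.carrier, IsOpen F → F ⊆ D₂ →
      Y.area (frontier (φ '' F)) = X.area (frontier F) := by
    intro F hF hF₂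
    rw [← φ.image_frontier_eq hF (hF₂.trans subset_closure) hφ.subset_source isClosed_closure hci]
    exact hφ.area_image (frontier_subset_closure.trans (closure_mono hF₂))
  have hreg : Y.IsRegion e' (φ '' D₁) := by
    have hopen : IsOpen (φ '' D₁) := φ.isOpen_image_of_subset_source hD₁.1 hD₁s
    obtain ⟨K, hK, -, hdiff⟩ := hD₁.exists_isCompact_diff_subset hD₂ h
    -- `K` may leave the source of `φ`, which is only known to contain `closure D₂`.
    have hK' : IsCompact (K ∩ closure D₂) := hK.inter_right isClosed_closure
    have hKi := hK'.image_of_continuousOn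
      (φ.continuousOn.mono (inter_subset_right.trans hφ.subset_source))
    obtain ⟨-, r, hr, hdisj, hc⟩ := hD'
    refine ⟨hopen, r, hr, hdisj.mono_left (himg ▸ image_mono hsub),
      (hc.union hKi).of_isClosed_subset (hopen.union (Y.isOpen_farEnd e' _)).isClosed_compl
        fun q hq => ?_⟩
    by_cases hqD : q ∈ D'
    · rw [← himg] at hqD
      obtain ⟨p, hp, rfl⟩ := hqD
      exact Or.inr ⟨p, ⟨hdiff ⟨hp, fun hp₁ => hq (Or.inl ⟨p, hp₁, rfl⟩)⟩, subset_closure hp⟩, rfl⟩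
    · exact Or.inl fun hmem => hmem.elim hqD fun h => hq (Or.inr h)
  refine ⟨φ '' D₁, ⟨hadm, hreg, φ, hφ.mono hsub', rfl, φ.image_closure_eq
    (hsub.trans subset_closure) hφ.subset_source isClosed_closure hci⟩, fun E hE hsubE => ?_⟩
  -- `F` is `E ∩ D'` pulled back to `X`, where `hmin₁` applies to it.
  obtain ⟨F, hFo, hF₁, hF₂, hFE⟩ : ∃ F : Set X.carrier, IsOpen F ∧ D₁ ⊆ F ∧ F ⊆ D₂ ∧
      φ '' F = E ∩ D' := by
    have hD₂s : D₂ ⊆ φ.source := subset_closure.trans hφ.subset_source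
    refine ⟨D₂ ∩ φ ⁻¹' E, (φ.continuousOn.mono hD₂s).isOpen_inter_preimage hD₂.1 hE.1,
      fun p hp => ⟨hsub hp, hsubE ⟨p, hp, rfl⟩⟩, inter_subset_left, ?_⟩
    rw [image_inter_preimage, himg, inter_comm]
  have hfin : Y.area (frontier D') < ⊤ := by
    rw [← himg, hfr D₂ hD₂.1 Subset.rfl]
    exact area_frontier_lt_top hD₂.1 hs₂ hD₂.isCompact_frontier
  calc Y.area (frontier (φ '' D₁)) = X.area (frontier D₁) := hfr D₁ hD₁.1 hsub
    _ ≤ X.area (frontier F) := hmin₁ F (hD₁.of_subset_of_subset hD₂ h hFo hF₁ hF₂) hF₁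
    _ = Y.area (frontier (E ∩ D')) := by rw [← hFE, hfr F hFo hF₂]
    _ ≤ Y.area (frontier E) := by
      -- Adding `|∂D'|` to both sides is reversible because it is finite.
      refine ENNReal.le_of_add_le_add_right hfin.ne ?_
      calc Y.area (frontier (E ∩ D')) + Y.area (frontier D')
          ≤ Y.area (frontier (E ∩ D')) + Y.area (frontier (E ∪ D')) := by
            gcongr
            exact hmin' _ (hE.union hD' hflat) subset_union_right
        _ ≤ _ := Y.area_frontier_inter_add_frontier_union_le hE.1 hD'.1

end CauchyData

theorem theorem6 (X : CauchyData.{u}) (e : OpenPartialHomeomorph X.carrier E3)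
    (hcomplete : X.IsComplete) (hflat : X.IsAsymptoticallyFlat e) (henergy : X.DominantEnergy)
    (D₁ D₂ : Set X.carrier)
    (hD₁ : X.IsRegion e D₁) (hD₂ : X.IsRegion e D₂)
    (hsmooth₁ : X.HasSmoothBoundary D₁) (hsmooth₂ : X.HasSmoothBoundary D₂)
    (hencl : D₁ ⊆ D₂)
    (hmin₁ : X.IsOuterMinimising e D₁) (hmin₂ : X.IsOuterMinimising e D₂) :
    X.innerMass D₁ ≤ X.innerMass D₂ ∧ X.outerMass D₁ ≤ X.outerMass D₂ := by
  constructor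
  · refine sSup_le_sSup ?_
    rintro _ ⟨Y, e', D', hf, rfl⟩
    obtain ⟨D'₂, hf₂⟩ := hf.exists_of_subset hflat hD₁ hD₂ hencl
    exact ⟨Y, e', D'₂, hf₂, rfl⟩
  · refine sInf_le_sInf ?_
    rintro _ ⟨Y, e', D', m, hY, hmin', hm, rfl⟩
    obtain ⟨D'₁, hY₁, hmin₁'⟩ :=
      hY.image_of_subset hflat hD₁ hD₂ hsmooth₂ hencl hmin₁ hmin'
    exact ⟨Y, e', D'₁, m, hY₁, hmin₁', hm, rfl⟩
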